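/- Let $M$ be a smooth ($C^\infty$, Hausdorff, without boundary) manifold of finite dimension $\dim M>2$. On $T^{big}M=TM\oplus T^*M$ consider the neutral metric $$g((X,\alpha),(Y,\beta))=\tfrac12(\alpha(Y)+\beta(X))$$ and the Courant bracket $$[(X,\alpha),(Y,\beta)]=\bigl([X,Y],\;L_X\beta-L_Y\alpha+\tfrac12 d(\alpha(Y)-\beta(X))\bigr).$$ A generalized almost complex structure is a smooth bundle endomorphism $\Phi$ of $T^{big}M$ with $\Phi^2=-\mathrm{Id}$ and $g(\mathcal X,\Phi\mathcal Y)+g(\Phi\mathcal X,\mathcal Y)=0$. It is called integrable, or a generalized complex structure, if $$[\Phi\mathcal X,\Phi\mathcal Y]-\Phi[\mathcal X,\Phi\mathcal Y]-\Phi[\Phi\mathcal X,\mathcal Y]+\Phi^2[\mathcal X,\mathcal Y]=0$$ for all smooth sections $\mathcal X,\mathcal Y$ of $T^{big}M$. Write $$\Phi=\begin{pmatrix}A&\sharp_\pi\\ \flat_\sigma&-{}^tA\end{pmatrix},\qquad \sharp_\pi\alpha=\pi(\alpha,\cdot),\quad \flat_\sigma X=\sigma(X,\cdot),$$ with $A\in\mathrm{End}(TM)$,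 a bivector field $\pi$ and a 2-form $\sigma$. Let $\Phi$ be a generalized complex structure on $M$ that satisfies one of the following conditions: 1. $\pi$ is nondegenerate at every point of $M$; 2. for every $x\in M$, $A_x^2\neq-\mathrm{Id}$ and $A_x$ has no real eigenvalue; 3. at every point of $M$, $\operatorname{rank}\pi>2$ and $\sigma$ is nondegenerate. For $\tau\in C^\infty(M)$ let $\mathcal C_\tau(X,\alpha)=(X,e^\tau\alpha)$, and let $\Phi'=\mathcal C_{-\tau}\circ\Phi\circ\mathcal C_\tau$, which is again a generalized almost complex structure, be the structure obtained from $\Phi$ by the conformal change $\mathcal C_\tau$. Then $\Phi'$ is integrable if and only if the conformal change is a homothety, i.e. $\tau$ is locally constant. -/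

import Mathlib

open Bundle Manifold VectorField
open scoped ContDiff

noncomputable section

namespace GenGeom

section

variable (E : Type*) [NormedAddCommGroup E] [NormedSpace ℝ E]
  {M : Type*} [TopologicalSpace M] [ChartedSpace E M]

/-- The cotangent space `T*_x M`. -/
abbrev Cotangent (x : M) : Type _ := TangentSpace 𝓘(ℝ, E) x →L[ℝ] ℝ

/-- The fibre `T_x M ⊕ T*_x M` of the big tangent bundle. -/
abbrev BigTangent (x : M) : Type _ := TangentSpace 𝓘(ℝ, E) x × Cotangent E x

variable (M) in
/-- The big tangent bundle `TM ⊕ T*M`: the Whitney sum of the tangent bundle and of the bundle of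
linear forms on it. It carries Mathlib's smooth vector bundle structure. -/
abbrev BigBundle : M → Type _ :=
  (fun x : M => TangentSpace 𝓘(ℝ, E) x) ×ᵇ (fun x : M => Cotangent E x)

variable {E}

/-- The differential of a function, as a 1-form. -/
def dFun (f : M → ℝ) (x : M) : Cotangent E x := mfderiv 𝓘(ℝ, E) 𝓘(ℝ, ℝ) f x

/-- A vector field read in the chart at `x₀`. -/
def chartField (x₀ : M) (X : ∀ x : M, TangentSpace 𝓘(ℝ, E) x) (y : E) : E :=
  mfderiv 𝓘(ℝ, E) 𝓘(ℝ, E) (extChartAt 𝓘(ℝ, E) x₀) ((extChartAt 𝓘(ℝ, E) x₀).symm y)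
    (X ((extChartAt 𝓘(ℝ, E) x₀).symm y))

/-- A 1-form read in the chart at `x₀`. -/
def chartForm (x₀ : M) (β : ∀ x : M, Cotangent E x) (y : E) : E →L[ℝ] ℝ :=
  (β ((extChartAt 𝓘(ℝ, E) x₀).symm y)).comp
    (mfderiv 𝓘(ℝ, E) 𝓘(ℝ, E) (extChartAt 𝓘(ℝ, E) x₀).symm y)

/-- The Lie derivative `L_X β` of a 1-form. At `x₀` it is computed in the chart at `x₀`, by
`(L_X β)_j = X^i ∂_i β_j + β_i ∂_j X^i`. -/
def lieDerivForm (X : ∀ x : M, TangentSpace 𝓘(ℝ, E) x) (β : ∀ x : M, Cotangent E x) (x₀ : M) :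
    Cotangent E x₀ :=
  ((fderiv ℝ (chartForm x₀ β) (extChartAt 𝓘(ℝ, E) x₀ x₀)
        (chartField x₀ X (extChartAt 𝓘(ℝ, E) x₀ x₀))
      + (chartForm x₀ β (extChartAt 𝓘(ℝ, E) x₀ x₀)).comp
        (fderiv ℝ (chartField x₀ X) (extChartAt 𝓘(ℝ, E) x₀ x₀)) : E →L[ℝ] ℝ)).comp
    (mfderiv 𝓘(ℝ, E) 𝓘(ℝ, E) (extChartAt 𝓘(ℝ, E) x₀) x₀)

/-- The neutral metric `g((X,α),(Y,β)) = (α(Y) + β(X)) / 2`. -/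
def neutralMetric {x : M} (u v : BigTangent E x) : ℝ := (1 / 2) * (u.2 v.1 + v.2 u.1)

/-- The Courant bracket
`[(X,α),(Y,β)] = ([X,Y], L_X β - L_Y α + (1/2) d(α(Y) - β(X)))`. -/
def courantBracket (u v : ∀ x : M, BigTangent E x) (x : M) : BigTangent E x :=
  (mlieBracket 𝓘(ℝ, E) (fun y => (u y).1) (fun y => (v y).1) x,
    lieDerivForm (fun y => (u y).1) (fun y => (v y).2) x
      - lieDerivForm (fun y => (v y).1) (fun y => (u y).2) x
      + (1 / 2 : ℝ) • dFun (fun y => (u y).2 (v y).1 - (v y).2 (u y).1) x)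

/-- The Nijenhuis torsion of `Φ` with respect to the Courant bracket. -/
def nijenhuis (Φ : ∀ x : M, BigTangent E x →L[ℝ] BigTangent E x)
    (u v : ∀ x : M, BigTangent E x) (x : M) : BigTangent E x :=
  courantBracket (fun y => Φ y (u y)) (fun y => Φ y (v y)) x
    - Φ x (courantBracket u (fun y => Φ y (v y)) x)
    - Φ x (courantBracket (fun y => Φ y (u y)) v x)
    + Φ x (Φ x (courantBracket u v x))

/-- The map `(X, α) ↦ (X, c α)` on `T_x M ⊕ T*_x M`. -/
def scaleForm (c : ℝ) (x : M) : BigTangent E x →L[ℝ] BigTangent E x :=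
  (ContinuousLinearMap.id ℝ (TangentSpace 𝓘(ℝ, E) x)).prodMap
    (c • ContinuousLinearMap.id ℝ (Cotangent E x))

/-- The conformal change `C_τ (X, α) = (X, e^τ α)` of the big tangent bundle. -/
def conformal (τ : M → ℝ) (x : M) : BigTangent E x →L[ℝ] BigTangent E x :=
  scaleForm (Real.exp (τ x)) x

theorem conformal_map_neg (τ : M → ℝ) {x : M} (u : BigTangent E x) :
    conformal τ x (-u) = -conformal τ x u :=
  Prod.ext rfl (smul_neg (Real.exp (τ x)) u.2)

theorem conformal_conformal_neg (τ : M → ℝ) {x : M} (u : BigTangent E x) :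
    conformal τ x (conformal (fun y => -τ y) x u) = u := by
  refine Prod.ext rfl ?_
  change Real.exp (τ x) • (Real.exp (-τ x) • u.2) = u.2
  rw [smul_smul, ← Real.exp_add, add_neg_cancel, Real.exp_zero, one_smul]

theorem conformal_neg_conformal (τ : M → ℝ) {x : M} (u : BigTangent E x) :
    conformal (fun y => -τ y) x (conformal τ x u) = u := by
  refine Prod.ext rfl ?_
  change Real.exp (-τ x) • (Real.exp (τ x) • u.2) = u.2
  rw [smul_smul, ← Real.exp_add, neg_add_cancel, Real.exp_zero, one_smul]

theorem neutralMetric_conformal (τ : M → ℝ) {x : M} (u v : BigTangent E x) :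
    neutralMetric (conformal τ x u) (conformal τ x v)
      = Real.exp (τ x) * neutralMetric u v := by
  change (1 / 2) * (Real.exp (τ x) * u.2 v.1 + Real.exp (τ x) * v.2 u.1)
    = Real.exp (τ x) * ((1 / 2) * (u.2 v.1 + v.2 u.1))
  ring

variable [IsManifold 𝓘(ℝ, E) ∞ M]

/-- Smoothness of a section of `TM ⊕ T*M`. -/
def SmoothSection (u : ∀ x : M, BigTangent E x) : Prop :=
  ContMDiff 𝓘(ℝ, E) (𝓘(ℝ, E).prod 𝓘(ℝ, E × (E →L[ℝ] ℝ))) ∞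
    (fun x => (TotalSpace.mk' (E × (E →L[ℝ] ℝ)) x (u x) :
      TotalSpace (E × (E →L[ℝ] ℝ)) (BigBundle E M)))

/-- Smoothness of an endomorphism of `TM ⊕ T*M`, as a section of the bundle of endomorphisms. -/
def SmoothEnd (Φ : ∀ x : M, BigTangent E x →L[ℝ] BigTangent E x) : Prop :=
  ContMDiff 𝓘(ℝ, E)
    (𝓘(ℝ, E).prod 𝓘(ℝ, (E × (E →L[ℝ] ℝ)) →L[ℝ] (E × (E →L[ℝ] ℝ)))) ∞
    (fun x => (TotalSpace.mk' ((E × (E →L[ℝ] ℝ)) →L[ℝ] (E × (E →L[ℝ] ℝ))) x (Φ x) :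
      TotalSpace ((E × (E →L[ℝ] ℝ)) →L[ℝ] (E × (E →L[ℝ] ℝ)))
        (fun x => BigBundle E M x →L[ℝ] BigBundle E M x)))

variable (E M) in
/-- A generalized almost complex structure: a smooth endomorphism `Φ` of `TM ⊕ T*M` with
`Φ² = -Id` that is skew-symmetric with respect to the neutral metric. -/
structure GACStructure where
  toEnd : ∀ x : M, BigTangent E x →L[ℝ] BigTangent E x
  smooth : SmoothEnd toEnd
  sq : ∀ (x : M) (u : BigTangent E x), toEnd x (toEnd x u) = -u
  skew : ∀ (x : M) (u v : BigTangent E x),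
    neutralMetric u (toEnd x v) + neutralMetric (toEnd x u) v = 0

/-- `Φ` is integrable (a generalized complex structure) if its Nijenhuis torsion vanishes. -/
def GACStructure.IsIntegrable (Φ : GACStructure E M) : Prop :=
  ∀ u v : (∀ x : M, BigTangent E x), SmoothSection u → SmoothSection v →
    ∀ x : M, nijenhuis Φ.toEnd u v x = 0

/-- The block `A : TM → TM` of `Φ`. -/
def GACStructure.A (Φ : GACStructure E M) (x : M) :
    TangentSpace 𝓘(ℝ, E) x →L[ℝ] TangentSpace 𝓘(ℝ, E) x :=
  (ContinuousLinearMap.fst ℝ _ _).comp ((Φ.toEnd x).comp (ContinuousLinearMap.inl ℝ _ _))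

/-- The block `♯_π : T*M → TM` of `Φ`. -/
def GACStructure.sharp (Φ : GACStructure E M) (x : M) :
    Cotangent E x →L[ℝ] TangentSpace 𝓘(ℝ, E) x :=
  (ContinuousLinearMap.fst ℝ _ _).comp ((Φ.toEnd x).comp (ContinuousLinearMap.inr ℝ _ _))

/-- The block `♭_σ : TM → T*M` of `Φ`. -/
def GACStructure.flat (Φ : GACStructure E M) (x : M) :
    TangentSpace 𝓘(ℝ, E) x →L[ℝ] Cotangent E x :=
  (ContinuousLinearMap.snd ℝ _ _).comp ((Φ.toEnd x).comp (ContinuousLinearMap.inl ℝ _ _))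

/-- The bivector field `π` of `Φ`, determined by `♯_π α = π(α, ·)`. -/
def GACStructure.bivector (Φ : GACStructure E M) (x : M) (α β : Cotangent E x) : ℝ :=
  β (Φ.sharp x α)

/-- The 2-form `σ` of `Φ`, determined by `♭_σ X = σ(X, ·)`. -/
def GACStructure.twoForm (Φ : GACStructure E M) (x : M) (X Y : TangentSpace 𝓘(ℝ, E) x) : ℝ :=
  Φ.flat x X Y

/-- `π` is nondegenerate at `x`. -/
def GACStructure.BivectorNondegAt (Φ : GACStructure E M) (x : M) : Prop :=
  ∀ α : Cotangent E x, (∀ β : Cotangent E x, Φ.bivector x α β = 0) → α = 0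

/-- `σ` is nondegenerate at `x`. -/
def GACStructure.TwoFormNondegAt (Φ : GACStructure E M) (x : M) : Prop :=
  ∀ X : TangentSpace 𝓘(ℝ, E) x,
    (∀ Y : TangentSpace 𝓘(ℝ, E) x, Φ.twoForm x X Y = 0) → X = 0

/-- The rank of `π` at `x`. -/
def GACStructure.bivectorRank (Φ : GACStructure E M) (x : M) : ℕ :=
  Module.finrank ℝ (LinearMap.range (Φ.sharp x).toLinearMap)

theorem contDiff_add_exp_smul {V : Type*} [NormedAddCommGroup V] [NormedSpace ℝ V] (a b : V) :
    ContDiff ℝ ∞ fun t : ℝ => a + Real.exp t • b :=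
  contDiff_const.add (Real.contDiff_exp.smul contDiff_const)

theorem scaleForm_inCoordinates (c d : ℝ) (x₀ x : M)
    (Ψ : BigTangent E x →L[ℝ] BigTangent E x) (hx : x ∈ (chartAt E x₀).source) :
    ContinuousLinearMap.inCoordinates (E × (E →L[ℝ] ℝ)) (BigBundle E M)
      (E × (E →L[ℝ] ℝ)) (BigBundle E M) x₀ x x₀ x
      ((scaleForm d x).comp (Ψ.comp (scaleForm c x))) =
    ((ContinuousLinearMap.id ℝ E).prodMap (d • ContinuousLinearMap.id ℝ (E →L[ℝ] ℝ))).comp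
      ((ContinuousLinearMap.inCoordinates (E × (E →L[ℝ] ℝ)) (BigBundle E M)
      (E × (E →L[ℝ] ℝ)) (BigBundle E M) x₀ x x₀ x Ψ).comp
      ((ContinuousLinearMap.id ℝ E).prodMap (c • ContinuousLinearMap.id ℝ (E →L[ℝ] ℝ)))) := by
  have hb : x ∈ (trivializationAt (E × (E →L[ℝ] ℝ)) (BigBundle E M) x₀).baseSet := by
    simp [hx]
  have h₁ : x ∈ (trivializationAt E (fun y : M => TangentSpace 𝓘(ℝ, E) y) x₀).baseSet := hb.1
  have h₂ : x ∈ (trivializationAt (E →L[ℝ] ℝ) (fun y : M => Cotangent E y) x₀).baseSet := hb.2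
  have hL : (trivializationAt (E × (E →L[ℝ] ℝ)) (BigBundle E M) x₀).continuousLinearEquivAt ℝ x hb
      = ((trivializationAt E (fun y : M => TangentSpace 𝓘(ℝ, E) y) x₀).continuousLinearEquivAt
          ℝ x h₁).prodCongr
        ((trivializationAt (E →L[ℝ] ℝ) (fun y : M => Cotangent E y) x₀).continuousLinearEquivAt
          ℝ x h₂) :=
    Trivialization.continuousLinearEquivAt_prod hb
  rw [ContinuousLinearMap.inCoordinates_eq hb hb, ContinuousLinearMap.inCoordinates_eq hb hb, hL]
  generalize (trivializationAt E (fun y : M => TangentSpace 𝓘(ℝ, E) y) x₀).continuousLinearEquivAt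
          ℝ x h₁ = L₁
  generalize (trivializationAt (E →L[ℝ] ℝ) (fun y : M => Cotangent E y) x₀).continuousLinearEquivAt
          ℝ x h₂ = L₂
  refine ContinuousLinearMap.ext fun w => ?_
  have e1 : (scaleForm c x) ((L₁.prodCongr L₂).symm w)
      = (L₁.prodCongr L₂).symm (w.1, c • w.2) :=
    Prod.ext rfl (map_smul L₂.symm c w.2).symm
  have e2 : ∀ z : BigTangent E x, (L₁.prodCongr L₂) (scaleForm d x z)
      = (((L₁.prodCongr L₂) z).1, d • ((L₁.prodCongr L₂) z).2) := fun z =>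
    Prod.ext rfl (map_smul L₂ d z.2)
  exact (congrArg (fun z => (L₁.prodCongr L₂) (scaleForm d x (Ψ z))) e1).trans (e2 _)

theorem smoothEnd_conformal {Φ : ∀ x : M, BigTangent E x →L[ℝ] BigTangent E x}
    (hΦ : SmoothEnd Φ) {τ : M → ℝ} (hτ : ContMDiff 𝓘(ℝ, E) 𝓘(ℝ, ℝ) ∞ τ) :
    SmoothEnd fun x => (conformal (fun y => -τ y) x).comp ((Φ x).comp (conformal τ x)) := by
  intro x₀
  have h := (contMDiffAt_hom_bundle _).1 (hΦ x₀)
  refine (contMDiffAt_hom_bundle _).2 ⟨h.1, ?_⟩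
  have key : ∀ f : M → ℝ, ContMDiff 𝓘(ℝ, E) 𝓘(ℝ, ℝ) ∞ f →
      ContMDiffAt 𝓘(ℝ, E) 𝓘(ℝ, (E × (E →L[ℝ] ℝ)) →L[ℝ] (E × (E →L[ℝ] ℝ))) ∞
        (fun x => ((ContinuousLinearMap.id ℝ E).prodMap
          (Real.exp (f x) • ContinuousLinearMap.id ℝ (E →L[ℝ] ℝ)))) x₀ := by
    intro f hf
    have hs : ContDiff ℝ ∞ (fun t : ℝ => (ContinuousLinearMap.id ℝ E).prodMap
        (Real.exp t • ContinuousLinearMap.id ℝ (E →L[ℝ] ℝ))) := by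
      have : (fun t : ℝ => (ContinuousLinearMap.id ℝ E).prodMap
          (Real.exp t • ContinuousLinearMap.id ℝ (E →L[ℝ] ℝ))) = fun t =>
          (ContinuousLinearMap.id ℝ E).prodMap (0 : (E →L[ℝ] ℝ) →L[ℝ] (E →L[ℝ] ℝ)) +
          Real.exp t • (0 : E →L[ℝ] E).prodMap (ContinuousLinearMap.id ℝ (E →L[ℝ] ℝ)) := by
        funext t
        refine ContinuousLinearMap.ext fun w => Prod.ext ?_ ?_
        · simp
        · simp
      rw [this]
      exact contDiff_add_exp_smul _ _
    exact hs.contMDiff.contMDiffAt.comp x₀ (hf x₀)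
  refine ((key _ hτ.neg).clm_comp (h.2.clm_comp (key _ hτ))).congr_of_eventuallyEq ?_
  filter_upwards [(chartAt E x₀).open_source.mem_nhds (mem_chart_source E x₀)] with x hx
  exact scaleForm_inCoordinates _ _ x₀ x (Φ x) hx

/-- The structure `Φ' = C_{-τ} ∘ Φ ∘ C_τ` obtained from `Φ` by the conformal change `C_τ`. -/
def GACStructure.conformalChange (Φ : GACStructure E M) (τ : C^∞⟮𝓘(ℝ, E), M; 𝓘(ℝ, ℝ), ℝ⟯) :
    GACStructure E M where
  toEnd x := (conformal (fun y => -τ y) x).comp ((Φ.toEnd x).comp (conformal τ x))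
  smooth := smoothEnd_conformal Φ.smooth τ.contMDiff
  sq x u := by
    change conformal (fun y => -τ y) x (Φ.toEnd x (conformal τ x (conformal (fun y => -τ y) x
      (Φ.toEnd x (conformal τ x u))))) = -u
    rw [conformal_conformal_neg, Φ.sq, conformal_map_neg, conformal_neg_conformal]
  skew x u v := by
    change neutralMetric u (conformal (fun y => -τ y) x (Φ.toEnd x (conformal τ x v)))
      + neutralMetric (conformal (fun y => -τ y) x (Φ.toEnd x (conformal τ x u))) v = 0
    have h := Φ.skew x (conformal τ x u) (conformal τ x v)
    have h1 := neutralMetric_conformal τ (x := x) u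
      (conformal (fun y => -τ y) x (Φ.toEnd x (conformal τ x v)))
    have h2 := neutralMetric_conformal τ (x := x)
      (conformal (fun y => -τ y) x (Φ.toEnd x (conformal τ x u))) v
    rw [conformal_conformal_neg] at h1 h2
    rw [h1, h2, ← mul_add] at h
    exact (mul_eq_zero.1 h).resolve_left (Real.exp_pos _).ne'

end

end GenGeom

end

/-! Write `θ = dτ`. Conjugating the Courant bracket by `C_τ` changes it only through Leibniz terms,
so the difference is tensorial, linear in `θ`, and has values in `T*M`. Consequently the torsion of
`Φ'`, evaluated on `C_{-τ}u` and `C_{-τ}v`, is `C_{-τ}` applied to the torsion of `Φ` plus a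
pointwise tensor `T_θ(u, v)`. Since `Φ` is integrable, `Φ'` is integrable exactly when `T_θ = 0` at
every point (`conformalChange_isIntegrable_iff`). If `τ` is locally constant then `θ = 0`, and so is
`T_θ`.

For the converse the `TM`-component of `T_θ = 0` suffices. With `Z = ♯θ` it yields three identities:
`α(Z) ♯β = β(Z) ♯α - π(α,β) Z`, `θ(Y) ♯♭X = θ(X) ♯♭Y + σ(X,Y) Z`, `θ(X) A♯β = θ(AX) ♯β`. If `Z ≠ 0`,
the first confines the image of `♯` to a plane, so rank `π > 2` forces `Z = 0`. For nondegenerate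
`π` this already gives `θ = 0`. For nondegenerate `σ`, the second with `Z = 0` and `θ ≠ 0` would
make the rank of `π` at most 1. If `A` has no real eigenvalue and `θ ≠ 0`, the third makes every
nonzero `♯β` an eigenvector; hence `♯ = 0`, and then `Φ² = -Id` gives `A² = -Id`, which is excluded.
-/

noncomputable section

namespace GenGeom

/-! ### Smooth sections, their chart expressions and local extensions -/

section Smoothness

variable {E : Type*} [NormedAddCommGroup E] [NormedSpace ℝ E]
  {M : Type*} [TopologicalSpace M] [ChartedSpace E M] [IsManifold 𝓘(ℝ, E) ∞ M]

/-- Smoothness of a 1-form, as a section of the cotangent bundle. -/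
abbrev SmoothForm (β : ∀ x : M, Cotangent E x) : Prop :=
  ContMDiff 𝓘(ℝ, E) (𝓘(ℝ, E).prod 𝓘(ℝ, E →L[ℝ] ℝ)) ∞
    (fun x => (TotalSpace.mk' (E →L[ℝ] ℝ) x (β x) :
      TotalSpace (E →L[ℝ] ℝ) (fun x : M => Cotangent E x)))

/-- Smoothness of a vector field, as a section of the tangent bundle. -/
abbrev SmoothField (X : ∀ x : M, TangentSpace 𝓘(ℝ, E) x) : Prop :=
  ContMDiff 𝓘(ℝ, E) (𝓘(ℝ, E).prod 𝓘(ℝ, E)) ∞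
    (fun x => (TotalSpace.mk' E x (X x) :
      TotalSpace E (fun x : M => TangentSpace 𝓘(ℝ, E) x)))

theorem smoothSection_iff (u : ∀ x : M, BigTangent E x) :
    SmoothSection u ↔ SmoothField (fun x => (u x).1) ∧ SmoothForm (fun x => (u x).2) := by
  refine ⟨fun h => ⟨fun x => ?_, fun x => ?_⟩, fun h x => ?_⟩
  · exact (contMDiffAt_section x).2
      ((ContinuousLinearMap.fst ℝ E (E →L[ℝ] ℝ)).contMDiff.contMDiffAt.comp x
        ((contMDiffAt_section x).1 (h x)))
  · exact (contMDiffAt_section x).2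
      ((ContinuousLinearMap.snd ℝ E (E →L[ℝ] ℝ)).contMDiff.contMDiffAt.comp x
        ((contMDiffAt_section x).1 (h x)))
  · exact (contMDiffAt_section x).2
      (((contMDiffAt_section x).1 (h.1 x)).prodMk_space ((contMDiffAt_section x).1 (h.2 x)))

theorem SmoothSection.conformal {u : ∀ x : M, BigTangent E x} (hu : SmoothSection u)
    {τ : M → ℝ} (hτ : ContMDiff 𝓘(ℝ, E) 𝓘(ℝ, ℝ) ∞ τ) :
    SmoothSection fun x => GenGeom.conformal τ x (u x) := by
  rw [smoothSection_iff] at hu ⊢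
  exact ⟨hu.1, (Real.contDiff_exp.contMDiff.comp hτ).smul_section hu.2⟩

theorem SmoothEnd.apply {Φ : ∀ x : M, BigTangent E x →L[ℝ] BigTangent E x} (hΦ : SmoothEnd Φ)
    {u : ∀ x : M, BigTangent E x} (hu : SmoothSection u) :
    SmoothSection fun x => Φ x (u x) :=
  fun x => (hΦ x).clm_bundle_apply (hu x)

theorem SmoothForm.mdifferentiableAt_apply {β : ∀ x : M, Cotangent E x} (hβ : SmoothForm β)
    {X : ∀ x : M, TangentSpace 𝓘(ℝ, E) x} (hX : SmoothField X) (x : M) :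
    MDifferentiableAt 𝓘(ℝ, E) 𝓘(ℝ, ℝ) (fun y => β y (X y)) x := by
  have h : ContMDiffAt 𝓘(ℝ, E) (𝓘(ℝ, E).prod 𝓘(ℝ, ℝ)) ∞
      (fun y => (TotalSpace.mk' ℝ y (β y (X y)) : TotalSpace ℝ (Bundle.Trivial M ℝ))) x :=
    ContMDiffAt.clm_bundle_apply (E₂ := Bundle.Trivial M ℝ) (hβ x) (hX x)
  exact ((contMDiffAt_section x).1 h).mdifferentiableAt (by simp)

/-- Near `x` the tangent trivialization is inverted by the derivative of the inverse chart, so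
`chartForm` agrees there with the coordinate expression of `β` in the cotangent bundle, which is
smooth. -/
theorem SmoothForm.differentiableAt_chartForm {β : ∀ x : M, Cotangent E x} (hβ : SmoothForm β)
    (x : M) : DifferentiableAt ℝ (chartForm x β) (extChartAt 𝓘(ℝ, E) x x) := by
  have h := ((contMDiffAt_hom_bundle _).1 (hβ x)).2
  have h' := ((contMDiffAt_iff_source).1 h)
  rw [ModelWithCorners.range_eq_univ, contMDiffWithinAt_univ, contMDiffAt_iff_contDiffAt] at h'
  refine (h'.differentiableAt (by simp)).congr_of_eventuallyEq ?_
  filter_upwards [extChartAt_target_mem_nhds (I := 𝓘(ℝ, E)) x] with y hy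
  have hs : (extChartAt 𝓘(ℝ, E) x).symm y ∈ (chartAt E x).source := by
    simpa using (extChartAt 𝓘(ℝ, E) x).map_target hy
  refine ContinuousLinearMap.ext fun v => ?_
  have key := TangentBundle.symmL_trivializationAt (I := 𝓘(ℝ, E)) hs
  rw [ModelWithCorners.range_eq_univ, mfderivWithin_univ, (extChartAt 𝓘(ℝ, E) x).right_inv hy]
    at key
  simp only [Function.comp, chartForm, ContinuousLinearMap.inCoordinates]
  erw [Bundle.Trivial.continuousLinearMapAt_trivialization]
  exact congrArg (fun L : E →L[ℝ] E => (β ((extChartAt 𝓘(ℝ, E) x).symm y) : E →L[ℝ] ℝ) (L v))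
    key.symm

variable (E) in
theorem isLocallyConstant_of_mfderiv_eq_zero {f : M → ℝ}
    (hf : ContMDiff 𝓘(ℝ, E) 𝓘(ℝ, ℝ) ∞ f)
    (hf' : ∀ x, mfderiv 𝓘(ℝ, E) 𝓘(ℝ, ℝ) f x = 0) : IsLocallyConstant f := by
  rw [IsLocallyConstant.iff_eventually_eq]
  intro x
  set e := extChartAt 𝓘(ℝ, E) x
  have hd : ∀ y ∈ e.target, HasFDerivAt (f ∘ e.symm) (0 : E →L[ℝ] ℝ) y := by
    intro y hy
    have h1 := (hf.mdifferentiableAt (x := e.symm y) (by simp)).hasMFDerivAt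
    rw [hf'] at h1
    have h2 : MDifferentiableAt 𝓘(ℝ, E) 𝓘(ℝ, E) e.symm y :=
      ((contMDiffOn_extChartAt_symm (n := ∞) x).contMDiffAt
        ((isOpen_extChartAt_target x).mem_nhds hy)).mdifferentiableAt (by simp)
    have h3 := h1.comp y h2.hasMFDerivAt
    rw [ContinuousLinearMap.zero_comp] at h3
    exact hasMFDerivAt_iff_hasFDerivAt.1 h3
  obtain ⟨r, hr, hb⟩ := Metric.isOpen_iff.1 (isOpen_extChartAt_target (I := 𝓘(ℝ, E)) x) (e x)
    (mem_extChartAt_target x)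
  filter_upwards [(continuousAt_extChartAt (I := 𝓘(ℝ, E)) x).preimage_mem_nhds
    (Metric.ball_mem_nhds _ hr), extChartAt_source_mem_nhds (I := 𝓘(ℝ, E)) x] with y hy hys
  have := Metric.isOpen_ball.is_const_of_fderiv_eq_zero (𝕜 := ℝ) (f := f ∘ e.symm)
    (convex_ball (e x) r).isPreconnected
    (fun z hz => (hd z (hb hz)).differentiableAt.differentiableWithinAt)
    (fun z hz => (hd z (hb hz)).fderiv) hy (Metric.mem_ball_self hr)
  rwa [Function.comp_apply, Function.comp_apply, e.left_inv hys,
    e.left_inv (mem_extChartAt_source x)] at this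

omit [IsManifold 𝓘(ℝ, E) ∞ M] in
theorem mfderiv_eq_zero_of_isLocallyConstant {f : M → ℝ} (hf : IsLocallyConstant f) (x : M) :
    mfderiv 𝓘(ℝ, E) 𝓘(ℝ, ℝ) f x = 0 := by
  rw [Filter.EventuallyEq.mfderiv_eq ((IsLocallyConstant.iff_eventually_eq f).1 hf x),
    mfderiv_const]

/-- Turns integrability, a condition on global sections, into a condition on vectors of one fibre:
the section with constant coordinates in a trivialization is cut off by a bump function equal to 1
at `x`. -/
theorem exists_smoothSection_eq [FiniteDimensional ℝ E] [T2Space M] (x : M)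
    (w : BigTangent E x) : ∃ u : ∀ y : M, BigTangent E y, SmoothSection u ∧ u x = w := by
  set e := trivializationAt (E × (E →L[ℝ] ℝ)) (BigBundle E M) x
  have hx : x ∈ e.baseSet := FiberBundle.mem_baseSet_trivializationAt' x
  set s : ∀ y : M, BigBundle E M y :=
    FiberBundle.extend (E × (E →L[ℝ] ℝ)) (E := BigBundle E M) (x := x) w
  have hs : ContMDiffOn 𝓘(ℝ, E) (𝓘(ℝ, E).prod 𝓘(ℝ, E × (E →L[ℝ] ℝ))) ∞
      (fun y => TotalSpace.mk' (E × (E →L[ℝ] ℝ)) y (s y)) e.baseSet := by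
    rw [e.contMDiffOn_section_baseSet_iff]
    refine (contMDiffOn_const (c := (e ⟨x, w⟩).2)).congr fun y hy => ?_
    have h := congrArg Prod.snd (e.apply_mk_symm hy (e ⟨x, w⟩).2)
    exact h
  obtain ⟨ψ, -, hψ⟩ := (SmoothBumpFunction.nhds_basis_tsupport (I := 𝓘(ℝ, E)) x).mem_iff.1
    (e.open_baseSet.mem_nhds hx)
  refine ⟨fun y => ψ y • s y, ?_, ?_⟩
  · exact ContMDiffOn.smul_section_of_tsupport ψ.contMDiff.contMDiffOn e.open_baseSet hψ hs
  · change ψ x • s x = w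
    rw [ψ.eq_one, one_smul]
    exact FiberBundle.extend_apply_self (F := E × (E →L[ℝ] ℝ)) (E := BigBundle E M) (x := x) w

end Smoothness

/-! ### Leibniz rules and the Courant bracket under a conformal change -/

section Bracket

variable {E : Type*} [NormedAddCommGroup E] [NormedSpace ℝ E]
  {M : Type*} [TopologicalSpace M] [ChartedSpace E M]

theorem dFun_mul {f h : M → ℝ} {x : M} (hf : MDifferentiableAt 𝓘(ℝ, E) 𝓘(ℝ, ℝ) f x)
    (hh : MDifferentiableAt 𝓘(ℝ, E) 𝓘(ℝ, ℝ) h x) :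
    dFun (E := E) (fun y => f y * h y) x = f x • dFun h x + h x • dFun f x :=
  (hf.hasMFDerivAt.mul hh.hasMFDerivAt).mfderiv

theorem dFun_exp {f : M → ℝ} {x : M} (hf : MDifferentiableAt 𝓘(ℝ, E) 𝓘(ℝ, ℝ) f x) :
    dFun (E := E) (fun y => Real.exp (f y)) x = Real.exp (f x) • dFun f x := by
  have h := ((Real.hasDerivAt_exp (f x)).hasFDerivAt.hasMFDerivAt.comp x hf.hasMFDerivAt).mfderiv
  refine h.trans (ContinuousLinearMap.ext fun v => ?_)
  change (dFun f x v : ℝ) * Real.exp (f x) = Real.exp (f x) * dFun f x v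
  ring

theorem dFun_neg (f : M → ℝ) (x : M) :
    dFun (E := E) (fun y => -f y) x = -dFun f x :=
  mfderiv_neg

/-- The derivative at `x` of the chart at `x`, read in the model space. -/
def chartDeriv (x : M) : TangentSpace 𝓘(ℝ, E) x →L[ℝ] E :=
  mfderiv 𝓘(ℝ, E) 𝓘(ℝ, E) (extChartAt 𝓘(ℝ, E) x) x

/-- The derivative at the image of `x` of the inverse of the chart at `x`. -/
def chartSymmDeriv (x : M) : E →L[ℝ] TangentSpace 𝓘(ℝ, E) x :=
  mfderiv 𝓘(ℝ, E) 𝓘(ℝ, E) (extChartAt 𝓘(ℝ, E) x).symm (extChartAt 𝓘(ℝ, E) x x)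

theorem chartField_self (x : M) (X : ∀ x : M, TangentSpace 𝓘(ℝ, E) x) :
    chartField x X (extChartAt 𝓘(ℝ, E) x x) = chartDeriv x (X x) :=
  congrArg (fun y => (mfderiv 𝓘(ℝ, E) 𝓘(ℝ, E) (extChartAt 𝓘(ℝ, E) x) y (X y) : E))
    ((extChartAt 𝓘(ℝ, E) x).left_inv (mem_extChartAt_source x))

theorem chartForm_self (x : M) (β : ∀ x : M, Cotangent E x) (v : E) :
    chartForm x β (extChartAt 𝓘(ℝ, E) x x) v = β x (chartSymmDeriv x v) :=
  congrArg (fun y => (β y : E →L[ℝ] ℝ) (chartSymmDeriv x v : TangentSpace 𝓘(ℝ, E) x))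
    ((extChartAt 𝓘(ℝ, E) x).left_inv (mem_extChartAt_source x))

variable [IsManifold 𝓘(ℝ, E) ∞ M]

theorem chartSymmDeriv_chartDeriv (x : M) (v : TangentSpace 𝓘(ℝ, E) x) :
    chartSymmDeriv x (chartDeriv x v) = v := by
  have : IsManifold 𝓘(ℝ, E) 1 M := IsManifold.of_le (n := ∞) (by simp)
  have h := mfderivWithin_extChartAt_symm_comp_mfderiv_extChartAt' (I := 𝓘(ℝ, E))
    (mem_extChartAt_source (I := 𝓘(ℝ, E)) x)
  rw [ModelWithCorners.range_eq_univ, mfderivWithin_univ] at h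
  exact congrArg (fun L : E →L[ℝ] E => L v) h

theorem hasFDerivAt_comp_extChartAt_symm {f : M → ℝ} {x : M}
    (hf : MDifferentiableAt 𝓘(ℝ, E) 𝓘(ℝ, ℝ) f x) :
    HasFDerivAt (f ∘ (extChartAt 𝓘(ℝ, E) x).symm)
      ((dFun f x).comp (chartSymmDeriv x)) (extChartAt 𝓘(ℝ, E) x x) := by
  have hs : MDifferentiableAt 𝓘(ℝ, E) 𝓘(ℝ, E) (extChartAt 𝓘(ℝ, E) x).symm
      (extChartAt 𝓘(ℝ, E) x x) :=
    ((contMDiffOn_extChartAt_symm (n := ∞) x).contMDiffAt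
      ((isOpen_extChartAt_target x).mem_nhds (mem_extChartAt_target x))).mdifferentiableAt (by simp)
  have h : HasMFDerivAt 𝓘(ℝ, E) 𝓘(ℝ, ℝ) f
      ((extChartAt 𝓘(ℝ, E) x).symm (extChartAt 𝓘(ℝ, E) x x)) (dFun f x : E →L[ℝ] ℝ) := by
    rw [(extChartAt 𝓘(ℝ, E) x).left_inv (mem_extChartAt_source x)]
    exact hf.hasMFDerivAt
  exact hasMFDerivAt_iff_hasFDerivAt.1 (h.comp _ hs.hasMFDerivAt)

/-- The Leibniz rule `L_X(fβ) = f L_X β + X(f) β`. In the chart only the term `X^i ∂_i β_j`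
differentiates `f`; the term with `∂_j X^i` is linear over functions. -/
theorem lieDerivForm_smul (X : ∀ x : M, TangentSpace 𝓘(ℝ, E) x) {f : M → ℝ}
    {β : ∀ x : M, Cotangent E x} {x : M}
    (hf : MDifferentiableAt 𝓘(ℝ, E) 𝓘(ℝ, ℝ) f x)
    (hβ : DifferentiableAt ℝ (chartForm x β) (extChartAt 𝓘(ℝ, E) x x)) :
    lieDerivForm X (fun y => f y • β y) x
      = f x • lieDerivForm X β x + (dFun f x (X x)) • β x := by
  set e := extChartAt 𝓘(ℝ, E) x
  have hfx : (f ∘ e.symm) (e x) = f x := congrArg f (e.left_inv (mem_extChartAt_source x))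
  have hd := ((hasFDerivAt_comp_extChartAt_symm hf).smul hβ.hasFDerivAt).fderiv
  refine ContinuousLinearMap.ext fun v => ?_
  have e1 : dFun f x (chartSymmDeriv x (chartField x X (e x)))
      = dFun f x (X x) := by
    rw [chartField_self, chartSymmDeriv_chartDeriv]
  have e2 : chartForm x β (e x) (chartDeriv x v) = β x v := by
    rw [chartForm_self, chartSymmDeriv_chartDeriv]
  have e3 : fderiv ℝ (chartForm x (fun y => f y • β y)) (e x) (chartField x X (e x))
      (chartDeriv x v)
      = f x * fderiv ℝ (chartForm x β) (e x) (chartField x X (e x)) (chartDeriv x v)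
        + dFun f x (X x) * β x v := by
    refine (congrArg (fun L : E →L[ℝ] E →L[ℝ] ℝ => L (chartField x X (e x)) (chartDeriv x v))
      hd).trans ?_
    change (f ∘ e.symm) (e x) * fderiv ℝ (chartForm x β) (e x) (chartField x X (e x))
      (chartDeriv x v) + dFun f x (chartSymmDeriv x
      (chartField x X (e x))) * chartForm x β (e x) (chartDeriv x v) = _
    rw [hfx, e1, e2]
  change fderiv ℝ (chartForm x (fun y => f y • β y)) (e x) (chartField x X (e x)) (chartDeriv x v)
      + (f ∘ e.symm) (e x) * chartForm x β (e x)
        (fderiv ℝ (chartField x X) (e x) (chartDeriv x v))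
    = f x * (fderiv ℝ (chartForm x β) (e x) (chartField x X (e x)) (chartDeriv x v)
        + chartForm x β (e x) (fderiv ℝ (chartField x X) (e x) (chartDeriv x v)))
      + dFun f x (X x) * β x v
  rw [e3, hfx]
  ring

omit [IsManifold 𝓘(ℝ, E) ∞ M] in
/-- The defect of the Courant bracket under a conformal change with logarithmic differential `θ`:
`((X,α),(Y,β)) ↦ (0, θ(Y) α - θ(X) β - (1/2) (α(Y) - β(X)) θ)`. -/
def conformalDefect {x : M} (θ : Cotangent E x) (a b : BigTangent E x) : BigTangent E x :=
  (0, θ b.1 • a.2 - θ a.1 • b.2 - ((1 / 2 : ℝ) * (a.2 b.1 - b.2 a.1)) • θ)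

/-- The vector parts are untouched by the rescaling. In the form part, each of the two Lie
derivatives and the exact term contributes one derivative of `e^σ`, namely `e^σ dσ`, and these three
contributions make up the defect. -/
theorem courantBracket_conformal {σ : M → ℝ} (hσ : ContMDiff 𝓘(ℝ, E) 𝓘(ℝ, ℝ) ∞ σ)
    {u v : ∀ x : M, BigTangent E x} (hu : SmoothSection u) (hv : SmoothSection v) (x : M) :
    courantBracket (fun y => conformal σ y (u y)) (fun y => conformal σ y (v y)) x
      = conformal σ x (courantBracket u v x - conformalDefect (dFun σ x) (u x) (v x)) := by
  rw [smoothSection_iff] at hu hv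
  have hσx : MDifferentiableAt 𝓘(ℝ, E) 𝓘(ℝ, ℝ) σ x := hσ.mdifferentiableAt (by simp)
  have hf : MDifferentiableAt 𝓘(ℝ, E) 𝓘(ℝ, ℝ) (fun y => Real.exp (σ y)) x :=
    (Real.contDiff_exp.contMDiff.comp hσ).mdifferentiableAt (n := ∞) (by simp)
  have hpair : MDifferentiableAt 𝓘(ℝ, E) 𝓘(ℝ, ℝ)
      (fun y => (u y).2 (v y).1 - (v y).2 (u y).1) x :=
    (hu.2.mdifferentiableAt_apply hv.1 x).sub (hv.2.mdifferentiableAt_apply hu.1 x)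
  have h1 := lieDerivForm_smul (fun y => (u y).1) hf (hv.2.differentiableAt_chartForm x)
  have h2 := lieDerivForm_smul (fun y => (v y).1) hf (hu.2.differentiableAt_chartForm x)
  have h3 := dFun_mul hf hpair
  rw [dFun_exp hσx] at h1 h2 h3
  have h4 : (fun y => Real.exp (σ y) * ((u y).2 (v y).1 - (v y).2 (u y).1))
      = fun y => (Real.exp (σ y) • (u y).2) (v y).1 - (Real.exp (σ y) • (v y).2) (u y).1 := by
    funext y
    exact mul_sub _ _ _
  rw [h4] at h3
  refine Prod.ext (sub_zero _).symm ?_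
  change lieDerivForm (fun y => (u y).1) (fun y => Real.exp (σ y) • (v y).2) x
      - lieDerivForm (fun y => (v y).1) (fun y => Real.exp (σ y) • (u y).2) x
      + (1 / 2 : ℝ) • dFun (fun y => (Real.exp (σ y) • (u y).2) (v y).1
        - (Real.exp (σ y) • (v y).2) (u y).1) x
    = Real.exp (σ x) • (lieDerivForm (fun y => (u y).1) (fun y => (v y).2) x
      - lieDerivForm (fun y => (v y).1) (fun y => (u y).2) x
      + (1 / 2 : ℝ) • dFun (fun y => (u y).2 (v y).1 - (v y).2 (u y).1) x
      - (dFun σ x (v x).1 • (u x).2 - dFun σ x (u x).1 • (v x).2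
        - ((1 / 2 : ℝ) * ((u x).2 (v x).1 - (v x).2 (u x).1)) • dFun σ x))
  rw [h1, h2, h3]
  have e1 : ∀ (w : TangentSpace 𝓘(ℝ, E) x), (Real.exp (σ x) • dFun σ x : Cotangent E x) w
    = Real.exp (σ x) * dFun σ x w := fun w => rfl
  rw [e1, e1]
  module

end Bracket

/-! ### Reduction of integrability to a pointwise tensor equation -/

section Torsion

variable {E : Type*} [NormedAddCommGroup E] [NormedSpace ℝ E]
  {M : Type*} [TopologicalSpace M] [ChartedSpace E M]

theorem conformalDefect_neg {x : M} (θ : Cotangent E x) (a b : BigTangent E x) :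
    conformalDefect (-θ) a b = -conformalDefect θ a b := by
  refine Prod.ext neg_zero.symm ?_
  change (-θ b.1) • a.2 - (-θ a.1) • b.2 - ((1 / 2 : ℝ) * (a.2 b.1 - b.2 a.1)) • (-θ)
    = -(θ b.1 • a.2 - θ a.1 • b.2 - ((1 / 2 : ℝ) * (a.2 b.1 - b.2 a.1)) • θ)
  module

theorem conformalDefect_zero {x : M} (a b : BigTangent E x) :
    conformalDefect 0 a b = 0 := by
  refine Prod.ext rfl ?_
  change (0 : ℝ) • a.2 - (0 : ℝ) • b.2 - ((1 / 2 : ℝ) * (a.2 b.1 - b.2 a.1)) • (0 : Cotangent E x)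
    = 0
  module

/-- The difference of the Nijenhuis torsions of a structure with value `L` at `x` before and after
a conformal change with logarithmic differential `θ`. -/
def torsionDefect {x : M} (L : BigTangent E x →L[ℝ] BigTangent E x) (θ : Cotangent E x)
    (a b : BigTangent E x) : BigTangent E x :=
  conformalDefect θ (L a) (L b) - L (conformalDefect θ a (L b)) - L (conformalDefect θ (L a) b)
    + L (L (conformalDefect θ a b))

theorem torsionDefect_zero {x : M} (L : BigTangent E x →L[ℝ] BigTangent E x)
    (a b : BigTangent E x) : torsionDefect L 0 a b = 0 := by
  simp only [torsionDefect, conformalDefect_zero, ContinuousLinearMap.map_zero, sub_zero, add_zero]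

variable [IsManifold 𝓘(ℝ, E) ∞ M]

/-- `Φ'` intertwines with `Φ` through `C_{-τ}`, so each of the four brackets in the torsion is a
bracket of sections rescaled by `-τ`. The sign of `-τ` turns the subtracted defect into an added
one. -/
theorem nijenhuis_conformalChange (Φ : GACStructure E M) (τ : C^∞⟮𝓘(ℝ, E), M; 𝓘(ℝ, ℝ), ℝ⟯)
    {u v : ∀ x : M, BigTangent E x} (hu : SmoothSection u) (hv : SmoothSection v) (x : M) :
    nijenhuis (Φ.conformalChange τ).toEnd (fun y => conformal (fun y => -τ y) y (u y))
        (fun y => conformal (fun y => -τ y) y (v y)) x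
      = conformal (fun y => -τ y) x
        (nijenhuis Φ.toEnd u v x + torsionDefect (Φ.toEnd x) (dFun τ x) (u x) (v x)) := by
  have hτ : ContMDiff 𝓘(ℝ, E) 𝓘(ℝ, ℝ) ∞ (fun y => -τ y) := τ.contMDiff.neg
  have hΦ : ∀ (y : M) (a : BigTangent E y), (Φ.conformalChange τ).toEnd y
      (conformal (fun y => -τ y) y a) = conformal (fun y => -τ y) y (Φ.toEnd y a) := fun y a =>
    congrArg (fun z => conformal (fun y => -τ y) y (Φ.toEnd y z)) (conformal_conformal_neg τ a)
  have hb : ∀ {p q : ∀ x : M, BigTangent E x}, SmoothSection p → SmoothSection q →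
      courantBracket (fun y => conformal (fun y => -τ y) y (p y))
          (fun y => conformal (fun y => -τ y) y (q y)) x
        = conformal (fun y => -τ y) x
          (courantBracket p q x + conformalDefect (dFun τ x) (p x) (q x)) := by
    intro p q hp hq
    rw [courantBracket_conformal hτ hp hq, dFun_neg, conformalDefect_neg, sub_neg_eq_add]
  have hu' := Φ.smooth.apply hu
  have hv' := Φ.smooth.apply hv
  simp only [nijenhuis, hΦ]
  rw [hb hu' hv', hb hu hv', hb hu' hv, hb hu hv]
  simp only [hΦ, ← ContinuousLinearMap.map_sub, ← ContinuousLinearMap.map_add, torsionDefect]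
  congr 1
  simp only [ContinuousLinearMap.map_add]
  abel

theorem conformalChange_isIntegrable_iff [FiniteDimensional ℝ E] [T2Space M]
    (Φ : GACStructure E M) (hΦ : Φ.IsIntegrable) (τ : C^∞⟮𝓘(ℝ, E), M; 𝓘(ℝ, ℝ), ℝ⟯) :
    (Φ.conformalChange τ).IsIntegrable ↔
      ∀ (x : M) (a b : BigTangent E x), torsionDefect (Φ.toEnd x) (dFun τ x) a b = 0 := by
  have hτ : ContMDiff 𝓘(ℝ, E) 𝓘(ℝ, ℝ) ∞ (fun y => -τ y) := τ.contMDiff.neg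
  constructor
  · intro h x a b
    obtain ⟨u, hu, rfl⟩ := exists_smoothSection_eq x a
    obtain ⟨v, hv, rfl⟩ := exists_smoothSection_eq x b
    have h1 := h _ _ (hu.conformal hτ) (hv.conformal hτ) x
    rw [nijenhuis_conformalChange Φ τ hu hv, hΦ u v hu hv, zero_add] at h1
    rw [← conformal_conformal_neg τ (torsionDefect (Φ.toEnd x) (dFun τ x) (u x) (v x)), h1,
      ContinuousLinearMap.map_zero]
  -- Every smooth section is `C_{-τ}` of the smooth section `C_τ u`, so the transformation formula
  -- covers all pairs.
  · intro h u v hu hv x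
    have h1 := nijenhuis_conformalChange Φ τ (hu.conformal τ.contMDiff)
      (hv.conformal τ.contMDiff) x
    rw [hΦ _ _ (hu.conformal τ.contMDiff) (hv.conformal τ.contMDiff), h, add_zero,
      ContinuousLinearMap.map_zero] at h1
    simpa only [conformal_neg_conformal] using h1

end Torsion

/-! ### Block identities and the tangent component of the torsion defect -/

section PointwiseAlgebra

variable {E : Type*} [NormedAddCommGroup E] [NormedSpace ℝ E]
  {M : Type*} [TopologicalSpace M] [ChartedSpace E M] [IsManifold 𝓘(ℝ, E) ∞ M]
  (Φ : GACStructure E M) {x : M}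

namespace GACStructure

theorem toEnd_apply_fst (X : TangentSpace 𝓘(ℝ, E) x) (α : Cotangent E x) :
    (Φ.toEnd x (X, α)).1 = Φ.A x X + Φ.sharp x α := by
  have h : ((X, α) : BigTangent E x) = (X, 0) + (0, α) := by simp
  rw [h, ContinuousLinearMap.map_add]
  rfl

theorem sharp_skew (α β : Cotangent E x) : α (Φ.sharp x β) = -β (Φ.sharp x α) := by
  have h : (1 / 2 : ℝ) * (α (Φ.sharp x β) + (Φ.toEnd x (0, β)).2 0)
      + (1 / 2) * ((Φ.toEnd x (0, α)).2 0 + β (Φ.sharp x α)) = 0 := Φ.skew x (0, α) (0, β)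
  rw [ContinuousLinearMap.map_zero, ContinuousLinearMap.map_zero] at h
  linarith

theorem flat_skew (X Y : TangentSpace 𝓘(ℝ, E) x) : Φ.flat x X Y = -Φ.flat x Y X := by
  have h : (1 / 2 : ℝ) * (0 + Φ.flat x Y X) + (1 / 2) * (Φ.flat x X Y + 0) = 0 :=
    Φ.skew x (X, 0) (Y, 0)
  linarith

theorem toEnd_inr_snd_apply (β : Cotangent E x) (X : TangentSpace 𝓘(ℝ, E) x) :
    (Φ.toEnd x (0, β)).2 X = -β (Φ.A x X) := by
  have h : (1 / 2 : ℝ) * (0 + (Φ.toEnd x (0, β)).2 X)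
      + (1 / 2) * ((Φ.toEnd x (X, 0)).2 0 + β (Φ.A x X)) = 0 := Φ.skew x (X, 0) (0, β)
  rw [ContinuousLinearMap.map_zero] at h
  linarith

/-- This is the `TM`-component of `Φ²(0, β) = -(0, β)`; it lets `A♯` replace `♯ ᵗA`. -/
theorem sharp_toEnd_inr_snd (β : Cotangent E x) :
    Φ.sharp x (Φ.toEnd x (0, β)).2 = -Φ.A x (Φ.sharp x β) := by
  have h := congrArg Prod.fst (Φ.sq x (0, β))
  have h' := Φ.toEnd_apply_fst (x := x) (Φ.sharp x β) (Φ.toEnd x (0, β)).2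
  have h2 : Φ.A x (Φ.sharp x β) + Φ.sharp x (Φ.toEnd x (0, β)).2 = -0 := h'.symm.trans h
  rw [neg_zero] at h2
  exact eq_neg_of_add_eq_zero_right h2

theorem A_sq_apply (X : TangentSpace 𝓘(ℝ, E) x) :
    Φ.A x (Φ.A x X) + Φ.sharp x (Φ.flat x X) = -X :=
  (Φ.toEnd_apply_fst (x := x) (Φ.A x X) (Φ.flat x X)).symm.trans
    (congrArg Prod.fst (Φ.sq x (X, 0)))

variable {Φ} {θ : Cotangent E x}

/-- Defects lie in `T*M`. Thus the first term of `torsionDefect` has no tangent part, and neither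
does the last because `Φ² = -Id`; only `♯` of the two mixed defects survives. -/
theorem sharp_conformalDefect_eq_zero {a b : BigTangent E x}
    (h : torsionDefect (Φ.toEnd x) θ a b = 0) :
    Φ.sharp x ((conformalDefect θ a (Φ.toEnd x b)).2
      + (conformalDefect θ (Φ.toEnd x a) b).2) = 0 := by
  have h1 := congrArg Prod.fst h
  rw [torsionDefect, Φ.sq] at h1
  have h2 : (0 : TangentSpace 𝓘(ℝ, E) x) - Φ.sharp x (conformalDefect θ a (Φ.toEnd x b)).2
      - Φ.sharp x (conformalDefect θ (Φ.toEnd x a) b).2 + -0 = 0 := h1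
  rw [ContinuousLinearMap.map_add, ← neg_eq_zero, ← h2]
  abel

variable (h : ∀ a b : BigTangent E x, torsionDefect (Φ.toEnd x) θ a b = 0)
include h

/-- Both arguments are 1-forms. By skewness of `π` the two half-coefficients of `θ` add up to `π(α,
β)`. -/
theorem wedge_sharp_eq_zero (α β : Cotangent E x) :
    α (Φ.sharp x θ) • Φ.sharp x β
      = β (Φ.sharp x θ) • Φ.sharp x α - β (Φ.sharp x α) • Φ.sharp x θ := by
  have h1 := sharp_conformalDefect_eq_zero (h (0, α) (0, β))
  have h2 : (conformalDefect θ (0, α) (Φ.toEnd x (0, β))).2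
      = θ (Φ.sharp x β) • α - θ 0 • (Φ.toEnd x (0, β)).2
        - ((1 / 2 : ℝ) * (α (Φ.sharp x β) - (Φ.toEnd x (0, β)).2 0)) • θ := rfl
  have h3 : (conformalDefect θ (Φ.toEnd x (0, α)) (0, β)).2
      = θ 0 • (Φ.toEnd x (0, α)).2 - θ (Φ.sharp x α) • β
        - ((1 / 2 : ℝ) * ((Φ.toEnd x (0, α)).2 0 - β (Φ.sharp x α))) • θ := rfl
  rw [h2, h3, ContinuousLinearMap.map_zero, ContinuousLinearMap.map_zero,
    ContinuousLinearMap.map_zero, Φ.sharp_skew θ β, Φ.sharp_skew θ α,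
    Φ.sharp_skew α β] at h1
  simp only [ContinuousLinearMap.map_add, ContinuousLinearMap.map_sub,
    ContinuousLinearMap.map_smul] at h1
  rw [← sub_eq_zero, ← h1]
  module

/-- Both arguments are vectors; skewness of `σ` again makes the two halves add. -/
theorem smul_sharp_flat_eq (X Y : TangentSpace 𝓘(ℝ, E) x) :
    θ Y • Φ.sharp x (Φ.flat x X)
      = θ X • Φ.sharp x (Φ.flat x Y) + Φ.flat x X Y • Φ.sharp x θ := by
  have h1 := sharp_conformalDefect_eq_zero (h (X, 0) (Y, 0))
  have h2 : (conformalDefect θ (X, 0) (Φ.toEnd x (Y, 0))).2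
      = θ (Φ.A x Y) • 0 - θ X • Φ.flat x Y - ((1 / 2 : ℝ) * (0 - Φ.flat x Y X)) • θ := rfl
  have h3 : (conformalDefect θ (Φ.toEnd x (X, 0)) (Y, 0)).2
      = θ Y • Φ.flat x X - θ (Φ.A x X) • 0 - ((1 / 2 : ℝ) * (Φ.flat x X Y - 0)) • θ := rfl
  rw [h2, h3, Φ.flat_skew Y X] at h1
  simp only [ContinuousLinearMap.map_add, ContinuousLinearMap.map_sub,
    ContinuousLinearMap.map_smul, ContinuousLinearMap.map_zero] at h1
  rw [← sub_eq_zero, ← h1]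
  module

/-- With one vector and one form, the two multiples of `θ` are `∓ β(AX)/2` and cancel, so no `♯θ`
term remains. -/
theorem smul_A_sharp_eq (X : TangentSpace 𝓘(ℝ, E) x) (β : Cotangent E x) :
    θ X • Φ.A x (Φ.sharp x β) = θ (Φ.A x X) • Φ.sharp x β := by
  have h1 := sharp_conformalDefect_eq_zero (h (X, 0) (0, β))
  have h2 : (conformalDefect θ (X, 0) (Φ.toEnd x (0, β))).2
      = θ (Φ.sharp x β) • 0 - θ X • (Φ.toEnd x (0, β)).2
        - ((1 / 2 : ℝ) * (0 - (Φ.toEnd x (0, β)).2 X)) • θ := rfl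
  have h3 : (conformalDefect θ (Φ.toEnd x (X, 0)) (0, β)).2
      = θ 0 • Φ.flat x X - θ (Φ.A x X) • β
        - ((1 / 2 : ℝ) * (Φ.flat x X 0 - β (Φ.A x X))) • θ := rfl
  rw [h2, h3, ContinuousLinearMap.map_zero, ContinuousLinearMap.map_zero,
    Φ.toEnd_inr_snd_apply β X] at h1
  simp only [ContinuousLinearMap.map_add, ContinuousLinearMap.map_sub,
    ContinuousLinearMap.map_smul, ContinuousLinearMap.map_zero,
    Φ.sharp_toEnd_inr_snd] at h1
  rw [← sub_eq_zero, ← h1]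
  module

end GACStructure

end PointwiseAlgebra

/-! ### Vanishing of `θ` under each of the three conditions -/

section PointwiseVanishing

variable {E : Type*} [NormedAddCommGroup E] [NormedSpace ℝ E]
  {M : Type*} [TopologicalSpace M] [ChartedSpace E M] [IsManifold 𝓘(ℝ, E) ∞ M]
  {Φ : GACStructure E M} {x : M} {θ : Cotangent E x}

omit [IsManifold 𝓘(ℝ, E) ∞ M] in
theorem exists_cotangent_apply_eq_one {Z : TangentSpace 𝓘(ℝ, E) x} (hZ : Z ≠ 0) :
    ∃ α : Cotangent E x, α Z = 1 :=
  SeparatingDual.exists_eq_one (R := ℝ) (V := E) hZ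

omit [IsManifold 𝓘(ℝ, E) ∞ M] in
theorem exists_apply_eq_one (hθ : θ ≠ 0) : ∃ X : TangentSpace 𝓘(ℝ, E) x, θ X = 1 := by
  obtain ⟨X, hX⟩ : ∃ X : TangentSpace 𝓘(ℝ, E) x, θ X ≠ 0 := by
    by_contra! h
    exact hθ (ContinuousLinearMap.ext h)
  refine ⟨(θ X)⁻¹ • X, ?_⟩
  rw [ContinuousLinearMap.map_smul, smul_eq_mul, inv_mul_cancel₀ hX]

namespace GACStructure

theorem bivectorRank_le_card {s : Finset (TangentSpace 𝓘(ℝ, E) x)}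
    (hs : ∀ β, Φ.sharp x β ∈ Submodule.span ℝ (s : Set (TangentSpace 𝓘(ℝ, E) x))) :
    Φ.bivectorRank x ≤ s.card := by
  have : Module.Finite ℝ (Submodule.span ℝ (s : Set (TangentSpace 𝓘(ℝ, E) x))) :=
    Module.Finite.span_finset ℝ s
  refine (Submodule.finrank_mono ?_).trans (finrank_span_finset_le_card s)
  rintro _ ⟨β, rfl⟩
  exact hs β

theorem sharp_injective_of_nondeg (h : Φ.BivectorNondegAt x) : Function.Injective (Φ.sharp x) := by
  refine (injective_iff_map_eq_zero (Φ.sharp x)).2 fun α hα => h α fun β => ?_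
  rw [bivector, hα, ContinuousLinearMap.map_zero]

theorem flat_injective_of_nondeg (h : Φ.TwoFormNondegAt x) : Function.Injective (Φ.flat x) := by
  refine (injective_iff_map_eq_zero (Φ.flat x)).2 fun X hX => h X fun Y => ?_
  rw [twoForm, hX]
  rfl

omit [IsManifold 𝓘(ℝ, E) ∞ M] in
theorem finrank_cotangent [FiniteDimensional ℝ E] (x : M) :
    Module.finrank ℝ (Cotangent E x) = Module.finrank ℝ E :=
  (LinearEquiv.finrank_eq (LinearMap.toContinuousLinearMap (𝕜 := ℝ) (E := E) (F' := ℝ))).symm.trans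
    Subspace.dual_finrank_eq

theorem bivectorRank_of_nondeg [FiniteDimensional ℝ E] (h : Φ.BivectorNondegAt x) :
    Φ.bivectorRank x = Module.finrank ℝ E :=
  (LinearMap.finrank_range_of_inj (f := (Φ.sharp x).toLinearMap)
    (sharp_injective_of_nondeg h)).trans (finrank_cotangent x)

theorem flat_surjective_of_nondeg [FiniteDimensional ℝ E] (h : Φ.TwoFormNondegAt x) :
    Function.Surjective (Φ.flat x) := by
  have : FiniteDimensional ℝ (TangentSpace 𝓘(ℝ, E) x) := inferInstanceAs (FiniteDimensional ℝ E)
  have : FiniteDimensional ℝ (Cotangent E x) := inferInstanceAs (FiniteDimensional ℝ (E →L[ℝ] ℝ))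
  exact (LinearMap.injective_iff_surjective_of_finrank_eq_finrank (f := (Φ.flat x).toLinearMap)
    (finrank_cotangent (E := E) x).symm).1 (flat_injective_of_nondeg h)

variable (h : ∀ a b : BigTangent E x, torsionDefect (Φ.toEnd x) θ a b = 0)
include h

theorem sharp_eq_zero_of_two_lt_bivectorRank (hr : 2 < Φ.bivectorRank x) : Φ.sharp x θ = 0 := by
  classical
  by_contra hZ
  obtain ⟨α, hα⟩ := exists_cotangent_apply_eq_one hZ
  -- With `α(♯θ) = 1` the first identity writes every `♯β` as a combination of `♯α` and `♯θ`, so the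
  -- rank would be at most 2.
  refine absurd (bivectorRank_le_card (Φ := Φ) (s := {Φ.sharp x α, Φ.sharp x θ}) fun β => ?_)
    (not_le.2 (Finset.card_le_two.trans_lt hr))
  have hβ := wedge_sharp_eq_zero h α β
  rw [hα, one_smul, sub_eq_add_neg, ← neg_smul] at hβ
  rw [Finset.coe_pair, Submodule.mem_span_pair]
  exact ⟨_, _, hβ.symm⟩

theorem eq_zero_of_bivectorNondegAt [FiniteDimensional ℝ E] (hdim : 2 < Module.finrank ℝ E)
    (hπ : Φ.BivectorNondegAt x) : θ = 0 :=
  sharp_injective_of_nondeg hπ ((sharp_eq_zero_of_two_lt_bivectorRank h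
    (hdim.trans_eq (bivectorRank_of_nondeg hπ).symm)).trans
      (ContinuousLinearMap.map_zero _).symm)

theorem eq_zero_of_twoFormNondegAt [FiniteDimensional ℝ E] (hr : 2 < Φ.bivectorRank x)
    (hσ : Φ.TwoFormNondegAt x) : θ = 0 := by
  classical
  by_contra hθ
  obtain ⟨X, hX⟩ := exists_apply_eq_one hθ
  have hZ := sharp_eq_zero_of_two_lt_bivectorRank h hr
  have hle : Φ.bivectorRank x ≤ 1 := by
    -- Every 1-form is some `♭Y`, and `♯♭Y = θ(Y) ♯♭X` since `θ(X) = 1` and `♯θ = 0`: the image of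
    -- `♯` is spanned by one vector.
    refine bivectorRank_le_card (Φ := Φ) (s := {Φ.sharp x (Φ.flat x X)}) fun β => ?_
    obtain ⟨Y, rfl⟩ := flat_surjective_of_nondeg hσ β
    have hY := smul_sharp_flat_eq h X Y
    rw [hX, one_smul, hZ, smul_zero, add_zero] at hY
    rw [Finset.coe_singleton, Submodule.mem_span_singleton]
    exact ⟨_, hY⟩
  omega

theorem eq_zero_of_forall_not_hasEigenvalue
    (hA : (Φ.A x).comp (Φ.A x) ≠ -ContinuousLinearMap.id ℝ (TangentSpace 𝓘(ℝ, E) x))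
    (hev : ∀ r : ℝ, ¬ Module.End.HasEigenvalue (Φ.A x).toLinearMap r) : θ = 0 := by
  by_contra hθ
  obtain ⟨X, hX⟩ := exists_apply_eq_one hθ
  have hsharp : ∀ β, Φ.sharp x β = 0 := by
    intro β
    by_contra hβ
    have hAβ := smul_A_sharp_eq h X β
    rw [hX, one_smul] at hAβ
    -- The eigenvalue is `θ(AX)`, with eigenvector `♯β`.
    exact hev _ (Module.End.hasEigenvalue_of_hasEigenvector
      ⟨Module.End.mem_eigenspace_iff.2 hAβ, hβ⟩)
  refine hA (ContinuousLinearMap.ext fun Y => ?_)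
  have hY := Φ.A_sq_apply Y
  rwa [hsharp, add_zero] at hY

end GACStructure

end PointwiseVanishing

end GenGeom

end

/-! ### The main equivalence -/

open GenGeom in
theorem proposition3p2 {E : Type*} [NormedAddCommGroup E] [NormedSpace ℝ E]
    [FiniteDimensional ℝ E] {M : Type*} [TopologicalSpace M] [T2Space M] [ChartedSpace E M]
    [IsManifold 𝓘(ℝ, E) ∞ M] (hdim : 2 < Module.finrank ℝ E)
    (Φ : GACStructure E M) (hΦ : Φ.IsIntegrable)
    (h : (∀ x : M, Φ.BivectorNondegAt x)
      ∨ (∀ x : M, (Φ.A x).comp (Φ.A x) ≠ -ContinuousLinearMap.id ℝ (TangentSpace 𝓘(ℝ, E) x)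
          ∧ ∀ r : ℝ, ¬ Module.End.HasEigenvalue (Φ.A x).toLinearMap r)
      ∨ ((∀ x : M, 2 < Φ.bivectorRank x) ∧ ∀ x : M, Φ.TwoFormNondegAt x))
    (τ : C^∞⟮𝓘(ℝ, E), M; 𝓘(ℝ, ℝ), ℝ⟯) :
    (Φ.conformalChange τ).IsIntegrable ↔ IsLocallyConstant τ := by
  rw [conformalChange_isIntegrable_iff Φ hΦ τ]
  constructor
  · intro hT
    refine isLocallyConstant_of_mfderiv_eq_zero E τ.contMDiff fun x => ?_
    rcases h with h | h | ⟨hr, hσ⟩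
    · exact GACStructure.eq_zero_of_bivectorNondegAt (hT x) hdim (h x)
    · exact GACStructure.eq_zero_of_forall_not_hasEigenvalue (hT x) (h x).1 (h x).2
    · exact GACStructure.eq_zero_of_twoFormNondegAt (hT x) (hr x) (hσ x)
  · intro hτ x a b
    rw [show dFun (E := E) τ x = 0 from mfderiv_eq_zero_of_isLocallyConstant hτ x,
      torsionDefect_zero]
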